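/- **Model (discrete-time, shared clock).** Time is $\mathbb T=\{0,1,2,\dots\}$. A context $\gamma$ consists of a (possibly infinite) set of agents, the vertices of a directed graph with edge set $N$; a bound $b(i,j)\in\{1,2,\dots\}\cup\{\infty\}$ for each edge $(i,j)\in N$; a set of states for each agent; a set of messages; and a set of external inputs, each input $\tilde e$ being observed by one agent $i_{\tilde e}$. A protocol $P$ gives each agent a nonempty set of initial states and a deterministic function that maps its previous state, the external inputs and the messages (with their senders) it observes now, and the current time, to a new state, a set of messages to send to out-neighbours, and the decision whether to respond now. In a run, states evolve according to $P$ from initial states, each external input occurs at most once, each message sent by $i$ to $j$ at time $t$ is delivered exactly once, at a time $t'$ with $t<t'\le t+b(i,j)$, and nothing else is delivered. The delivery is early if $t'<t+b(i,j)$. The nondeterministic (ND) events of a run are its external inputs and early deliveries. A run is triggered if $\tilde e$ occurs in it. $P$ is a full-information protocol if in its runs the state of each agent determines all events it has observed so far with their times, and at every time each agent sends every out-neighbour exactly one message, which determines the sender's current state and the current time. **Problem.** Let $I$ be a set of agents and let $\delta$ assign a value $\delta(i,j)\in\mathbb Z\cup\{-\infty,\infty\}$ to each ordered pair of distinct elements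 of $I$. A protocol $P$ solves $\mathrm{TCR}(\tilde e,I,\delta)$ if in each triggered run $r$ every $i\in I$ responds exactly once, at a time $\mathsf t_r(i)$, with $\mathsf t_r(j)\le \mathsf t_r(i)+\delta(i,j)$ for all distinct $i,j\in I$, and in each untriggered run no $i\in I$ responds (then $\mathsf t_r(i)=\infty$). **Centipedes.** On agent-time pairs, let $\dashrightarrow$ be the reflexive-transitive relation generated by $(i,t)\dashrightarrow(i,t')$ for $t\le t'$ and $(i,t)\dashrightarrow(j,t+b(i,j))$ for $(i,j)\in N$ with $b(i,j)<\infty$; let $\rightsquigarrow_r$ be generated by the same pairs together with $(i,t)\rightsquigarrow_r(j,t')$ whenever a message sent by $i$ at $t$ is delivered to $j$ at $t'$ in $r$. An event stands for the pair of its observer and its time; for events, $e\rightsquigarrow_r e'$ means that $e=e'$ or that $e'$ is the delivery of a message sent by some $i$ at some $t$ with $e\rightsquigarrow_r(i,t)$. Let $G_\delta$ be the directed graph on $I$ whose edges are the pairs of distinct $i,j$ with $\delta(i,j)\neq\infty$. For a path $p=(p_1,\dots,p_n)$ in $G_\delta$ ($n\ge1$, vertices may repeat), a $(p,\delta)$-traversing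 $\tilde e$-centipede by $t$ in $r$ is a tuple $(e_1,\dots,e_n)$ of ND events of $r$ such that $\tilde e\rightsquigarrow_r e_n$, $e_{m+1}\rightsquigarrow_r e_m$ for $1\le m<n$, and, for each $m\le n$, $t+\sum_{k<m}\delta(p_k,p_{k+1})$ is an element of $\mathbb T$ and $e_m\dashrightarrow\bigl(p_m,\,t+\sum_{k<m}\delta(p_k,p_{k+1})\bigr)$. **Statement.** For every context $\gamma$, external input $\tilde e$, set $I$ of agents, and $\delta$ as above, the following is an optimal response logic for $\mathrm{TCR}(\tilde e,I,\delta)$: each $i\in I$ responds at the earliest time by which, for every path $p$ in $G_\delta$ starting at $i$, a $(p,\delta)$-traversing $\tilde e$-centipede exists. That is, suppose that $\mathrm{TCR}(\tilde e,I,\delta)$ is solved by some protocol, and let $P$ be any full-information protocol. Then $P$ can be modified, by changing only when the agents of $I$ respond, into a protocol in whose runs the agents of $I$ respond exactly according to this logic. Every such protocol $P'$ has the same runs as $P$ and 1. $P'$ solves $\mathrm{TCR}(\tilde e,I,\delta)$; 2. if $P$ solves $\mathrm{TCR}(\tilde e,I,\delta)$, then in every run each $i\in I$ responds under $P'$ no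 later than under $P$; 3. more generally, let $P_0$ be any protocol that solves $\mathrm{TCR}(\tilde e,I,\delta)$ and $r_0$ a run of $P_0$. Say that a run $r$ of $P'$ matches $r_0$ if the same external inputs occur at the same times in both and, for every message delivered in $r_0$, a message sent by the same agent to the same agent at the same time is delivered in $r$ no later. Then some run of $P'$ matches $r_0$, and in every run of $P'$ that matches $r_0$ each $i\in I$ responds no later than in $r_0$. -/

import Mathlib

universe u v w x

namespace TimelyResponse

/-- Possible values of a timing constraint in discrete time: `ℤ ∪ {-∞, ∞}`. -/
abbrev ExtInt : Type := WithBot (WithTop ℤ)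

/-- A context: a weighted directed communication graph on the (possibly infinitely many) agents,
whose weights are positive integers or infinite, a set of states for each agent, a set of messages,
and a set of external inputs, each with the agent that observes it. -/
structure Context where
  Agent : Type u
  State : Agent → Type v
  Msg : Type w
  Input : Type x
  /-- `Nbr i j`: agent `i` may send messages to agent `j`. -/
  Nbr : Agent → Agent → Prop
  /-- Maximal delivery time from `i` to `j`; only relevant when `Nbr i j`. -/
  bound : Agent → Agent → ℕ∞
  bound_pos : ∀ i j, Nbr i j → 0 < bound i j
  /-- The agent observing an external input. -/
  inputAgent : Input → Agent

/-- An event: an external input, or the delivery to `j` of message `m` sent by `i` at `sentAt`. -/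
inductive Event (γ : Context.{u, v, w, x}) where
  | input (e : γ.Input) : Event γ
  | delivery (m : γ.Msg) (sentAt : ℕ) (i j : γ.Agent) : Event γ

/-- The agent that observes an event. -/
def Event.observer {γ : Context.{u, v, w, x}} : Event γ → γ.Agent
  | .input e => γ.inputAgent e
  | .delivery _ _ _ j => j

/-- What an agent does at one time: its new state, the messages it sends to its neighbours,
and whether it responds. -/
structure Action (γ : Context.{u, v, w, x}) (i : γ.Agent) where
  state : γ.State i
  send : Set (γ.Msg × {j // γ.Nbr i j})
  respond : Prop

/-- A joint protocol in a shared-clock model: for each agent, a nonempty set of initial states, and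
an action function of the previous state, the observed external inputs, the observed messages (with
their senders), and the current time. -/
structure Protocol (γ : Context.{u, v, w, x}) where
  init : ∀ i, Set (γ.State i)
  init_nonempty : ∀ i, (init i).Nonempty
  act : ∀ i, γ.State i → Set {e : γ.Input // γ.inputAgent e = i} →
    Set (γ.Msg × γ.Agent) → ℕ → Action γ i

/-- A possible history: the initial states, and, at each time, the events that take place and the
states of the agents. -/
structure History (γ : Context.{u, v, w, x}) where
  init : ∀ i, γ.State i
  env : ℕ → Set (Event γ)
  state : ∀ i, ℕ → γ.State i

section Runs

variable {γ : Context.{u, v, w, x}}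

/-- The state of `i` just before time `t`. -/
def History.before (r : History γ) (i : γ.Agent) : ℕ → γ.State i
  | 0 => r.init i
  | t + 1 => r.state i t

/-- The external inputs observed by `i` at `t`. -/
def History.inputsAt (r : History γ) (i : γ.Agent) (t : ℕ) :
    Set {e : γ.Input // γ.inputAgent e = i} :=
  {e | Event.input e.1 ∈ r.env t}

/-- The messages (with their senders) observed by `i` at `t`. -/
def History.messagesAt (r : History γ) (i : γ.Agent) (t : ℕ) : Set (γ.Msg × γ.Agent) :=
  {mk | ∃ sentAt, Event.delivery mk.1 sentAt mk.2 i ∈ r.env t}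

/-- The events observed by `i` up until, and including, `t`, with their occurrence times. -/
def History.observedUpTo (r : History γ) (i : γ.Agent) (t : ℕ) : Set (Event γ × ℕ) :=
  {a | a.2 ≤ t ∧ a.1 ∈ r.env a.2 ∧ a.1.observer = i}

/-- The action that `P` prescribes to `i` at `t` in `r`. -/
def Protocol.actionAt (P : Protocol γ) (r : History γ) (i : γ.Agent) (t : ℕ) : Action γ i :=
  P.act i (r.before i t) (r.inputsAt i t) (r.messagesAt i t) t

/-- Under `P`, agent `i` sends `m` to its neighbour `j` at `t` in `r`. -/
def Protocol.Sends (P : Protocol γ) (r : History γ) (i j : γ.Agent) (m : γ.Msg) (t : ℕ) : Prop :=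
  ∃ h : γ.Nbr i j, (m, ⟨j, h⟩) ∈ (P.actionAt r i t).send

/-- Under `P`, agent `i` responds at `t` in `r`. -/
def Protocol.Responds (P : Protocol γ) (r : History γ) (i : γ.Agent) (t : ℕ) : Prop :=
  (P.actionAt r i t).respond

/-- `r` is a run of `P`. -/
structure Protocol.IsRun (P : Protocol γ) (r : History γ) : Prop where
  init_mem : ∀ i, r.init i ∈ P.init i
  state_eq : ∀ i t, r.state i t = (P.actionAt r i t).state
  input_once : ∀ e t t', Event.input e ∈ r.env t → Event.input e ∈ r.env t' → t = t'
  /-- Every sent message is delivered exactly once. -/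
  delivered : ∀ i j m t, P.Sends r i j m t → ∃! t', Event.delivery m t i j ∈ r.env t'
  /-- Only sent messages are delivered, after they are sent and within the bound. -/
  delivery_legal : ∀ i j m t t', Event.delivery m t i j ∈ r.env t' →
    P.Sends r i j m t ∧ t < t' ∧ (t' : ℕ∞) ≤ t + γ.bound i j

/-- The set of runs of `P`. -/
def Protocol.runs (P : Protocol γ) : Set (History γ) := {r | P.IsRun r}

/-- The external input `e` occurs in `r`. -/
def History.Triggered (r : History γ) (e : γ.Input) : Prop := ∃ t, Event.input e ∈ r.env t

/-- The response time of `i` in `r`, which is `∞` if `i` does not respond. -/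
noncomputable def Protocol.respTime (P : Protocol γ) (r : History γ) (i : γ.Agent) : ℕ∞ :=
  sInf {s : ℕ∞ | ∃ t : ℕ, P.Responds r i t ∧ s = t}

/-- A full-information protocol (in a shared-clock model): the state of an agent determines all the
events it has observed so far, and, at every time, each agent sends each neighbour one message,
which determines the current state of the sender and the current time. -/
def Protocol.IsFullInformation (P : Protocol γ) : Prop :=
  (∃ remember : ∀ i, γ.State i → Set (Event γ × ℕ),
    ∀ r ∈ P.runs, ∀ i t, remember i (r.state i t) = r.observedUpTo i t) ∧
  (∃ decode : ∀ i, γ.Msg → γ.State i × ℕ,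
    ∀ r ∈ P.runs, ∀ i j t, γ.Nbr i j →
      (∃! m, P.Sends r i j m t) ∧
      ∀ m, P.Sends r i j m t → decode i m = (r.state i t, t))

end Runs

section Problems

variable {γ : Context.{u, v, w, x}}

/-- The eventual response problem, as the set of protocols solving it. -/
def eventualResponse (e : γ.Input) (I : Set γ.Agent) : Set (Protocol γ) :=
  {P | ∀ r ∈ P.runs,
    (r.Triggered e → ∀ i ∈ I, ∃! t, P.Responds r i t) ∧
    (¬ r.Triggered e → ∀ i ∈ I, ∀ t, ¬ P.Responds r i t)}

/-- `t` (restricted to `I`) is an implementation of the constraining function `δ`. Here and below,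
only the values of `δ` on pairs of distinct elements of `I` matter. -/
def IsImplementation {A : Type u} (I : Set A) (δ : A → A → ExtInt) (t : A → ℕ) : Prop :=
  ∀ i ∈ I, ∀ j ∈ I, i ≠ j → (t j : ExtInt) ≤ (t i : ExtInt) + δ i j

/-- The timely-coordinated response problem `TCR(e, I, δ)`, as the set of protocols solving it. -/
def timelyCoordinatedResponse (e : γ.Input) (I : Set γ.Agent)
    (δ : γ.Agent → γ.Agent → ExtInt) : Set (Protocol γ) :=
  {P | P ∈ eventualResponse e I ∧
    ∀ r ∈ P.runs, r.Triggered e → IsImplementation I δ (fun i => (P.respTime r i).toNat)}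

end Problems

section Syncausality

variable {γ : Context.{u, v, w, x}}

/-- Generators of the syncausality relation on agent-time pairs. -/
inductive SyncStep (r : History γ) : γ.Agent × ℕ → γ.Agent × ℕ → Prop
  | locality (i : γ.Agent) (t t' : ℕ) : t ≤ t' → SyncStep r (i, t) (i, t')
  | message (m : γ.Msg) (i j : γ.Agent) (t t' : ℕ) : t < t' →
      Event.delivery m t i j ∈ r.env t' → SyncStep r (i, t) (j, t')
  | guarantee (i j : γ.Agent) (t b : ℕ) : γ.Nbr i j → γ.bound i j = b →
      SyncStep r (i, t) (j, t + b)

/-- The syncausality relation of `r`. -/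
def Syncausal (r : History γ) : γ.Agent × ℕ → γ.Agent × ℕ → Prop :=
  Relation.ReflTransGen (SyncStep r)

/-- Generators of the bound guarantee relation on agent-time pairs. -/
inductive BoundStep (γ : Context.{u, v, w, x}) : γ.Agent × ℕ → γ.Agent × ℕ → Prop
  | locality (i : γ.Agent) (t t' : ℕ) : t ≤ t' → BoundStep γ (i, t) (i, t')
  | guarantee (i j : γ.Agent) (t b : ℕ) : γ.Nbr i j → γ.bound i j = b →
      BoundStep γ (i, t) (j, t + b)

/-- The bound guarantee relation of `γ`. -/
def BoundGuarantee (γ : Context.{u, v, w, x}) : γ.Agent × ℕ → γ.Agent × ℕ → Prop :=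
  Relation.ReflTransGen (BoundStep γ)

/-- An event together with its occurrence time. -/
abbrev TimedEvent (γ : Context.{u, v, w, x}) : Type _ := Event γ × ℕ

/-- The agent-time pair at which a timed event is observed. -/
def TimedEvent.node (a : TimedEvent γ) : γ.Agent × ℕ := (a.1.observer, a.2)

/-- The nondeterministic events of `r`: external inputs and early deliveries. -/
def History.nd (r : History γ) : Set (TimedEvent γ) :=
  {a | a.1 ∈ r.env a.2 ∧
    match a.1 with
    | .input _ => True
    | .delivery _ sentAt i j => (a.2 : ℕ∞) < sentAt + γ.bound i j}

/-- Syncausality between events: they coincide, or the second one is the delivery of a message whose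
sending is syncausally preceded by the first one. -/
def EventSyncausal (r : History γ) (a b : TimedEvent γ) : Prop :=
  a = b ∨ ∃ m t i j, b.1 = Event.delivery m t i j ∧ Syncausal r a.node (i, t)

end Syncausality

section Centipedes

/-- `p 0, …, p n` is a path in the graph `G_δ`, whose vertices are the elements of `I` and whose
edges are the pairs of distinct vertices at which `δ` is not `∞`. The values `p m` for `m > n` are
irrelevant. -/
def IsPath {A : Type u} (I : Set A) (δ : A → A → ExtInt) (n : ℕ) (p : ℕ → A) : Prop :=
  (∀ m ≤ n, p m ∈ I) ∧ ∀ m < n, p m ≠ p (m + 1) ∧ δ (p m) (p (m + 1)) ≠ ⊤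

/-- The length in `G_δ` of the initial segment `p 0, …, p m` of a path. -/
def pathLength {A : Type u} (δ : A → A → ExtInt) (p : ℕ → A) (m : ℕ) : ExtInt :=
  ∑ k ∈ Finset.range m, δ (p k) (p (k + 1))

variable {γ : Context.{u, v, w, x}}

/-- The nondeterministic events `a 0, …, a n` of `r` form a `((p 0, …, p n), δ)`-traversing
`e`-centipede by `t`. -/
def IsTraversingCentipede (r : History γ) (e : γ.Input) (δ : γ.Agent → γ.Agent → ExtInt)
    (n : ℕ) (p : ℕ → γ.Agent) (a : ℕ → TimedEvent γ) (t : ℕ) : Prop :=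
  (∀ m ≤ n, a m ∈ r.nd) ∧
  (∃ t₀, Event.input e ∈ r.env t₀ ∧ EventSyncausal r (Event.input e, t₀) (a n)) ∧
  (∀ m < n, EventSyncausal r (a (m + 1)) (a m)) ∧
  ∀ m ≤ n, ∃ s : ℕ, (s : ExtInt) = (t : ExtInt) + pathLength δ p m ∧
    BoundGuarantee γ (a m).node (p m, s)

/-- By time `t` in `r`, a `(p, δ)`-traversing `e`-centipede exists for every path `p` in `G_δ`
starting at `i`. -/
def AllCentipedesBy (e : γ.Input) (I : Set γ.Agent) (δ : γ.Agent → γ.Agent → ExtInt)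
    (r : History γ) (i : γ.Agent) (t : ℕ) : Prop :=
  ∀ (n : ℕ) (p : ℕ → γ.Agent), IsPath I δ n p → p 0 = i →
    ∃ a : ℕ → TimedEvent γ, IsTraversingCentipede r e δ n p a t

/-- A rule that says in which runs and at which times each agent is to respond. -/
def ResponseLogic (γ : Context.{u, v, w, x}) : Type _ := History γ → γ.Agent → ℕ → Prop

/-- "Respond at the earliest time by which, for every path `p` in `G_δ` starting at `i`, a
`(p, δ)`-traversing `e`-centipede exists." -/
def centipedeLogic (e : γ.Input) (I : Set γ.Agent) (δ : γ.Agent → γ.Agent → ExtInt) :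
    ResponseLogic γ :=
  fun r i t => IsLeast {s | AllCentipedesBy e I δ r i s} t

end Centipedes

section Optimality

variable {γ : Context.{u, v, w, x}}

/-- `P'` is obtained from `P` by changing only when the agents of `I` respond, so as to follow the
response logic `ρ`. -/
structure EndowedWith (I : Set γ.Agent) (ρ : ResponseLogic γ) (P P' : Protocol γ) : Prop where
  init_eq : ∀ i, P'.init i = P.init i
  state_eq : ∀ i s E M t, (P'.act i s E M t).state = (P.act i s E M t).state
  send_eq : ∀ i s E M t, (P'.act i s E M t).send = (P.act i s E M t).send
  respond_eq : ∀ i, i ∉ I → ∀ s E M t, ((P'.act i s E M t).respond ↔ (P.act i s E M t).respond)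
  follows : ∀ r ∈ P'.runs, ∀ i ∈ I, ∀ t, P'.Responds r i t ↔ ρ r i t

/-- `r` (typically a run of a full-information protocol) matches `r₀` (a run of any protocol): the
same external inputs occur at the same times, and for every message delivered in `r₀`, a message
sent at the same time along the same channel is delivered in `r` no later. -/
def Matches (r₀ r : History γ) : Prop :=
  (∀ e t, Event.input e ∈ r₀.env t ↔ Event.input e ∈ r.env t) ∧
  ∀ m t i j s, Event.delivery m t i j ∈ r₀.env s →
    ∃ m', ∃ s' ≤ s, Event.delivery m' t i j ∈ r.env s'

/-- `ρ` is an optimal response logic for the coordinated response problem `CP` of the agents `I`.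
Assume that `CP` is solvable. Every full-information protocol `P` can be endowed with `ρ`, and the
resulting protocol `P'` (which has the same runs as `P`) solves `CP`. If `P` itself solves `CP`, then
in no run does an agent of `I` respond later under `P'` than under `P`. More generally, this holds
for any solving protocol `P₀` and all matching runs of `P₀` and `P'`, and each run of `P₀` is matched
by a run of `P'`. -/
def IsOptimalResponseLogic (I : Set γ.Agent) (CP : Set (Protocol γ)) (ρ : ResponseLogic γ) :
    Prop :=
  CP.Nonempty → ∀ P : Protocol γ, P.IsFullInformation →
    (∃ P', EndowedWith I ρ P P') ∧
    ∀ P', EndowedWith I ρ P P' →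
      P' ∈ CP ∧
      P'.runs = P.runs ∧
      (P ∈ CP → ∀ r ∈ P.runs, ∀ i ∈ I, P'.respTime r i ≤ P.respTime r i) ∧
      ∀ P₀ ∈ CP, ∀ r₀ ∈ P₀.runs,
        (∃ r ∈ P'.runs, Matches r₀ r) ∧
        ∀ r ∈ P'.runs, Matches r₀ r → ∀ i ∈ I, P'.respTime r i ≤ P₀.respTime r₀ i

end Optimality

end TimelyResponse

/-! Necessity is the core: in a run of a solving protocol, an agent that responds by `t` has a
centipede by `t` for each path in `G_δ` starting at it (`exists_centipede`). The proof is an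
indistinguishability argument. `exists_truncation` alters a run outside the causal past of `(p 0,
t)`: inputs outside are deleted, deliveries outside are postponed as far as possible. The agent `p
0` cannot tell the difference and still responds, so the trigger lies in its past. For longer paths,
`p 1` must still respond in the altered run, by `t + δ (p 0) (p 1)`; induction gives a centipede
there, and its head, being nondeterministic, lies in the retained past. Hence the centipede exists
in the original run too, and the last nondeterministic event on a chain from its head to `(p 0, t)`
extends it (`exists_last_nd`).

Two facts turn this into optimality. Matching runs of a full-information protocol have at least the
causality of the original run, so they inherit its centipedes; and matching runs exist in both
directions, which gives existence and earliness of responses. The logic also meets the constraints: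
a path from `j` can be prolonged by an edge `(i, j)`, so all centipedes for `i` by `t` yield all
those for `j` by `t + δ i j`.

Finally, the logic is implementable because a full-information state determines the whole causal
past, in which the events of the centipedes lie. -/

namespace TimelyResponse

variable {γ : Context.{u, v, w, x}}

/-! ### Syncausality and bound guarantees -/

section Causality

variable {r : History γ} {y z : γ.Agent × ℕ}

theorem BoundStep.syncStep (h : BoundStep γ y z) : SyncStep r y z := by
  cases h with
  | locality i t t' h => exact .locality i t t' h
  | guarantee i j t b h hb => exact .guarantee i j t b h hb

theorem BoundGuarantee.syncausal (h : BoundGuarantee γ y z) : Syncausal r y z :=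
  Relation.ReflTransGen.mono (fun _ _ => BoundStep.syncStep) _ _ h

theorem SyncStep.time_le (h : SyncStep r y z) : y.2 ≤ z.2 := by
  cases h with
  | locality i t t' h => exact h
  | message m i j t t' h => exact h.le
  | guarantee i j t b => exact Nat.le_add_right t b

theorem Syncausal.time_le (h : Syncausal r y z) : y.2 ≤ z.2 := by
  induction h with
  | refl => exact le_rfl
  | tail _ h ih => exact ih.trans h.time_le

theorem Syncausal.of_le (i : γ.Agent) {s t : ℕ} (h : s ≤ t) : Syncausal r (i, s) (i, t) :=
  .single (.locality i s t h)

theorem EventSyncausal.syncausal {P : Protocol γ} (hr : P.IsRun r) {a b : TimedEvent γ}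
    (hb : b.1 ∈ r.env b.2) (h : EventSyncausal r a b) : Syncausal r a.node b.node := by
  obtain rfl | ⟨m, t, i, j, hm, h⟩ := h
  · exact .refl
  · rw [hm] at hb
    have hnode : b.node = (j, b.2) := by rw [TimedEvent.node, hm, Event.observer]
    rw [hnode]
    exact h.tail (.message m i j t b.2 (hr.delivery_legal i j m t b.2 hb).2.1 hb)

/-- Along a syncausal chain that starts at a nondeterministic event, the part after the last
nondeterministic event is a bound guarantee. -/
theorem Syncausal.exists_last_nd {P : Protocol γ} (hr : P.IsRun r) {a : TimedEvent γ}
    (ha : a ∈ r.nd) (h : Syncausal r a.node z) :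
    ∃ b ∈ r.nd, EventSyncausal r a b ∧ BoundGuarantee γ b.node z := by
  induction h with
  | refl => exact ⟨a, ha, .inl rfl, .refl⟩
  | tail hay hyz ih =>
    obtain ⟨b, hb, hab, hby⟩ := ih
    cases hyz with
    | locality i t t' h => exact ⟨b, hb, hab, hby.tail (.locality i t t' h)⟩
    | guarantee i j t d hN hd => exact ⟨b, hb, hab, hby.tail (.guarantee i j t d hN hd)⟩
    | message m i j t t' htt' hm =>
      obtain ⟨⟨hN, -⟩, -, hle⟩ := hr.delivery_legal i j m t t' hm
      -- An early delivery is itself nondeterministic and becomes the new last event; a delivery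
      -- exactly at the bound is a guarantee step, and that bound is finite because `t'` is.
      rcases hle.lt_or_eq with hlt | heq
      · exact ⟨(.delivery m t i j, t'), ⟨hm, hlt⟩, .inr ⟨m, t, i, j, rfl, hay⟩, .refl⟩
      · have hd : γ.bound i j ≠ ⊤ := by
          intro htop
          rw [htop, add_top] at heq
          exact ENat.natCast_ne_top _ heq
        obtain ⟨d, hd⟩ := ENat.ne_top_iff_exists.1 hd
        rw [← hd] at heq
        obtain rfl : t' = t + d := by exact_mod_cast heq
        exact ⟨b, hb, hab, hby.tail (.guarantee i j t d hN hd.symm)⟩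

end Causality

/-! ### Construction and truncation of runs -/

section Scheduling

/-- The states just before time `n`, and the messages `m` sent by `i` to `j` at times `t < n`, when
the inputs occur according to `inp` and messages are delivered at the times given by `D`. -/
def Protocol.simulate (P : Protocol γ) (s₀ : ∀ i, γ.State i) (inp : γ.Input → ℕ → Prop)
    (D : γ.Msg → ℕ → γ.Agent → γ.Agent → ℕ) :
    ℕ → (∀ i, γ.State i) × (γ.Msg → ℕ → γ.Agent → γ.Agent → Prop)
  | 0 => (s₀, fun _ _ _ _ => False)
  | n + 1 =>
    let H := P.simulate s₀ inp D n
    let A := fun i => P.act i (H.1 i) {e | inp e.1 n}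
      {mk | ∃ t, H.2 mk.1 t mk.2 i ∧ D mk.1 t mk.2 i = n} n
    (fun i => (A i).state,
      fun m t i j => H.2 m t i j ∨ t = n ∧ ∃ h, (m, ⟨j, h⟩) ∈ (A i).send)

/-- The history in which the inputs occur according to `inp` and messages are delivered at the times
given by `D`. -/
def Protocol.schedule (P : Protocol γ) (s₀ : ∀ i, γ.State i) (inp : γ.Input → ℕ → Prop)
    (D : γ.Msg → ℕ → γ.Agent → γ.Agent → ℕ) : History γ where
  init := s₀
  env n := {a | match a with
    | .input e => inp e n
    | .delivery m t i j => (P.simulate s₀ inp D n).2 m t i j ∧ D m t i j = n}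
  state i n := (P.simulate s₀ inp D (n + 1)).1 i

/-- Inputs and legal delivery times can be prescribed arbitrarily. -/
theorem Protocol.exists_isRun (P : Protocol γ) {s₀ : ∀ i, γ.State i} (hs : ∀ i, s₀ i ∈ P.init i)
    {inp : γ.Input → ℕ → Prop} (hinp : ∀ e t t', inp e t → inp e t' → t = t')
    {D : γ.Msg → ℕ → γ.Agent → γ.Agent → ℕ}
    (hD : ∀ m t i j, γ.Nbr i j → t < D m t i j ∧ (D m t i j : ℕ∞) ≤ t + γ.bound i j) :
    ∃ r, P.IsRun r ∧ r.init = s₀ ∧ (∀ e t, Event.input e ∈ r.env t ↔ inp e t) ∧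
      ∀ m t i j s, Event.delivery m t i j ∈ r.env s ↔ P.Sends r i j m t ∧ D m t i j = s := by
  set r := P.schedule s₀ inp D with hr
  have hbefore : ∀ i n, r.before i n = (P.simulate s₀ inp D n).1 i := fun i n => by
    cases n <;> rfl
  have hact : ∀ i n, P.actionAt r i n = P.act i ((P.simulate s₀ inp D n).1 i) {e | inp e.1 n}
      {mk | ∃ t, (P.simulate s₀ inp D n).2 mk.1 t mk.2 i ∧ D mk.1 t mk.2 i = n} n := fun i n => by
    rw [Protocol.actionAt, hbefore]
    rfl
  have hsent : ∀ m t i j n, (P.simulate s₀ inp D n).2 m t i j ↔ t < n ∧ P.Sends r i j m t := by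
    intro m t i j n
    induction n with
    | zero => simp [Protocol.simulate]
    | succ n ih =>
      have hstep : (P.simulate s₀ inp D (n + 1)).2 m t i j ↔
          (P.simulate s₀ inp D n).2 m t i j ∨ t = n ∧ P.Sends r i j m n := by
        rw [Protocol.Sends, hact]
        rfl
      rw [hstep, ih, Nat.lt_succ_iff_lt_or_eq]
      constructor
      · rintro (⟨h, hm⟩ | ⟨rfl, hm⟩)
        exacts [⟨.inl h, hm⟩, ⟨.inr rfl, hm⟩]
      · rintro ⟨h | rfl, hm⟩
        exacts [.inl ⟨h, hm⟩, .inr ⟨rfl, hm⟩]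
  have hdel : ∀ m t i j s,
      Event.delivery m t i j ∈ r.env s ↔ P.Sends r i j m t ∧ D m t i j = s := by
    intro m t i j s
    change (P.simulate s₀ inp D s).2 m t i j ∧ D m t i j = s ↔ _
    rw [hsent]
    constructor
    · rintro ⟨⟨-, h⟩, h'⟩
      exact ⟨h, h'⟩
    · rintro ⟨h, rfl⟩
      exact ⟨⟨(hD m t i j h.choose).1, h⟩, rfl⟩
  refine ⟨r, ⟨hs, fun i t => ?_, fun e t t' => hinp e t t', fun i j m t h => ?_,
    fun i j m t t' h => ?_⟩, rfl, fun _ _ => Iff.rfl, hdel⟩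
  · rw [hact]
    rfl
  · exact ⟨D m t i j, (hdel _ _ _ _ _).2 ⟨h, rfl⟩, fun s hs => ((hdel _ _ _ _ _).1 hs).2.symm⟩
  · obtain ⟨hm, rfl⟩ := (hdel _ _ _ _ _).1 h
    exact ⟨hm, hD m t i j hm.choose⟩

/-- Between neighbours, a message can be delivered as late as the bound allows, or, if the bound is
infinite, later than any given time. -/
theorem Context.exists_late (γ : Context.{u, v, w, x}) (T t : ℕ) (i j : γ.Agent) :
    ∃ d : ℕ, (γ.Nbr i j → t < d ∧ (d : ℕ∞) ≤ t + γ.bound i j) ∧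
      ((d : ℕ∞) = t + γ.bound i j ∨ T < d) := by
  by_cases hb : γ.bound i j = ⊤
  · exact ⟨max t T + 1, fun _ => ⟨by omega, by simp [hb]⟩, .inr (by omega)⟩
  · obtain ⟨b, hb⟩ := ENat.ne_top_iff_exists.1 hb
    refine ⟨t + b, fun h => ⟨?_, by simp [← hb]⟩, .inl (by simp [← hb])⟩
    have := γ.bound_pos i j h
    rw [← hb] at this
    have : 0 < b := by exact_mod_cast this
    omega

theorem Protocol.IsRun.delivery_unique {P : Protocol γ} {r : History γ} (hr : P.IsRun r)
    {m : γ.Msg} {t : ℕ} {i j : γ.Agent} {s s' : ℕ} (h : Event.delivery m t i j ∈ r.env s)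
    (h' : Event.delivery m t i j ∈ r.env s') : s = s' :=
  (hr.delivered i j m t (hr.delivery_legal i j m t s h).1).unique h (h')

/-- A run can be modified outside a causally closed set `V` of agent-time pairs so that all its
nondeterministic events until time `T` belong to `V`, and so do all its inputs. -/
theorem Protocol.IsRun.exists_truncation {P : Protocol γ} {r : History γ} (hr : P.IsRun r)
    {V : Set (γ.Agent × ℕ)} (hV : ∀ y z, SyncStep r y z → z ∈ V → y ∈ V) {T : ℕ}
    (hT : ∀ z ∈ V, z.2 ≤ T) :
    ∃ r', P.IsRun r' ∧ (∀ j s, (j, s) ∈ V → P.actionAt r' j s = P.actionAt r j s) ∧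
      (∀ a : TimedEvent γ, a.node ∈ V → (a.1 ∈ r'.env a.2 ↔ a.1 ∈ r.env a.2)) ∧
      (∀ b ∈ r'.nd, b.2 ≤ T → b.node ∈ V) ∧
      ∀ e t, Event.input e ∈ r'.env t → (γ.inputAgent e, t) ∈ V := by
  -- Deliveries inside `V` keep their times. All others are made non-early, or, if the bound is
  -- infinite, moved beyond the horizon `T`.
  have hex : ∀ m t i j, ∃ d : ℕ, (γ.Nbr i j → t < d ∧ (d : ℕ∞) ≤ t + γ.bound i j) ∧
      ((Event.delivery m t i j ∈ r.env d ∧ (j, d) ∈ V) ∨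
        (∀ s, Event.delivery m t i j ∈ r.env s → (j, s) ∉ V) ∧
          ((d : ℕ∞) = t + γ.bound i j ∨ T < d)) := by
    intro m t i j
    by_cases h : ∃ s, Event.delivery m t i j ∈ r.env s ∧ (j, s) ∈ V
    · obtain ⟨s, hs, hsV⟩ := h
      exact ⟨s, fun _ => (hr.delivery_legal i j m t s hs).2, .inl ⟨hs, hsV⟩⟩
    · push Not at h
      obtain ⟨d, hd, hd'⟩ := γ.exists_late T t i j
      exact ⟨d, hd, .inr ⟨h, hd'⟩⟩
  choose D hD hDV using hex
  obtain ⟨r', hr', hinit, hinp, hdel⟩ := P.exists_isRun hr.init_mem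
    (inp := fun e t => Event.input e ∈ r.env t ∧ (γ.inputAgent e, t) ∈ V)
    (fun e t t' h h' => hr.input_once e t t' h.1 h'.1) hD
  -- Actions at `V` depend only on earlier points of `V`, since `V` is causally closed; hence
  -- induction on time.
  have key : ∀ s j, (j, s) ∈ V → P.actionAt r' j s = P.actionAt r j s ∧
      ∀ a : Event γ, a.observer = j → (a ∈ r'.env s ↔ a ∈ r.env s) := by
    intro s
    induction s using Nat.strong_induction_on with
    | _ s ih =>
    intro j hj
    have henv : ∀ a : Event γ, a.observer = j → (a ∈ r'.env s ↔ a ∈ r.env s) := by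
      rintro (e | ⟨m, t, i, k⟩) rfl
      · rw [hinp]
        exact and_iff_left hj
      · simp only [Event.observer] at hj
        rw [hdel]
        constructor
        · rintro ⟨hm, rfl⟩
          rcases hDV m t i k with h | ⟨h, h' | h'⟩
          · exact h.1
          -- A postponed delivery cannot land in `V` at its bound: the sending would be in `V` by
          -- the guarantee step, so the message is also sent in `r` and arrives there no later,
          -- again in `V`, contrary to `h`.
          · exfalso
            have hN := hm.choose
            have htop : γ.bound i k ≠ ⊤ := by
              intro htop
              rw [htop, add_top] at h'
              exact ENat.natCast_ne_top _ h'
            obtain ⟨b, hb⟩ := ENat.ne_top_iff_exists.1 htop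
            rw [← hb] at h'
            have h' : D m t i k = t + b := by exact_mod_cast h'
            have hV' : (i, t) ∈ V := hV _ _ (.guarantee i k t b hN hb.symm) (h' ▸ hj)
            have hsend : P.Sends r i k m t := by
              rw [Protocol.Sends, ← (ih t (hD m t i k hN).1 i hV').1]
              exact hm
            obtain ⟨t', ht', -⟩ := hr.delivered i k m t hsend
            have hle := (hr.delivery_legal i k m t t' ht').2.2
            rw [← hb] at hle
            have hle : t' ≤ t + b := by exact_mod_cast hle
            exact h t' ht' (hV _ _ (.locality k t' (t + b) hle) (h' ▸ hj))
          · exact absurd (hT _ hj) (by simpa using h')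
        · intro h
          obtain ⟨hs, hlt, -⟩ := hr.delivery_legal i k m t s h
          have hV' : (i, t) ∈ V := hV _ _ (.message m i k t s hlt h) hj
          refine ⟨?_, ?_⟩
          · rw [Protocol.Sends, (ih t hlt i hV').1]
            exact hs
          · rcases hDV m t i k with h' | h'
            · exact hr.delivery_unique h'.1 h
            · exact absurd hj (h'.1 s h)
    refine ⟨?_, henv⟩
    have hbefore : r'.before j s = r.before j s := by
      cases s with
      | zero => exact congrFun hinit j
      | succ s =>
        change r'.state j s = r.state j s
        rw [hr'.state_eq, hr.state_eq,
          (ih s (Nat.lt_succ_self s) j (hV _ _ (.locality j s (s + 1) s.le_succ) hj)).1]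
    have hi : r'.inputsAt j s = r.inputsAt j s := Set.ext fun e => henv (.input e.1) e.2
    have hm : r'.messagesAt j s = r.messagesAt j s :=
      Set.ext fun mk => exists_congr fun t => henv (.delivery mk.1 t mk.2 j) rfl
    rw [Protocol.actionAt, Protocol.actionAt, hbefore, hi, hm]
  refine ⟨r', hr', fun j s h => (key s j h).1, fun a h => (key a.2 _ h).2 a.1 rfl, ?_,
    fun e t h => ((hinp e t).1 h).2⟩
  rintro ⟨e | ⟨m, t, i, j⟩, s⟩ ⟨hs, hnd⟩ hsT
  · exact ((hinp e s).1 hs).2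
  · obtain ⟨-, rfl⟩ := (hdel m t i j s).1 hs
    rcases hDV m t i j with h | ⟨-, h | h⟩
    · exact h.2
    · exact absurd h (ne_of_lt hnd)
    · exact absurd hsT (not_le_of_gt h)

end Scheduling

/-! ### Transfer of centipedes between agreeing runs -/

section Agreement

variable {r r' : History γ} {V : Set (γ.Agent × ℕ)}

theorem SyncStep.of_agree (hV : ∀ a : TimedEvent γ, a.node ∈ V → a.1 ∈ r.env a.2 → a.1 ∈ r'.env a.2)
    {y z : γ.Agent × ℕ} (h : SyncStep r y z) (hz : z ∈ V) : SyncStep r' y z := by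
  cases h with
  | locality i t t' h => exact .locality i t t' h
  | message m i j t t' h hm => exact .message m i j t t' h (hV (.delivery m t i j, t') hz hm)
  | guarantee i j t b h hb => exact .guarantee i j t b h hb

theorem Syncausal.mem_of_mem (hV : ∀ y z, SyncStep r y z → z ∈ V → y ∈ V) {y z : γ.Agent × ℕ}
    (h : Syncausal r y z) (hz : z ∈ V) : y ∈ V := by
  induction h with
  | refl => exact hz
  | tail _ h ih => exact ih (hV _ _ h hz)

theorem Syncausal.of_agree (hcl : ∀ y z, SyncStep r y z → z ∈ V → y ∈ V)
    (hV : ∀ a : TimedEvent γ, a.node ∈ V → a.1 ∈ r.env a.2 → a.1 ∈ r'.env a.2)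
    {y z : γ.Agent × ℕ} (h : Syncausal r y z) (hz : z ∈ V) : Syncausal r' y z := by
  induction h with
  | refl => exact .refl
  | tail _ h ih => exact (ih (hcl _ _ h hz)).tail (h.of_agree hV hz)

/-- Centipedes whose first event is in a causally closed set of agent-time pairs exist in all runs
that agree on this set. -/
theorem IsTraversingCentipede.of_agree {P : Protocol γ} (hr : P.IsRun r)
    (hcl : ∀ y z, SyncStep r y z → z ∈ V → y ∈ V)
    (hV : ∀ a : TimedEvent γ, a.node ∈ V → a.1 ∈ r.env a.2 → a.1 ∈ r'.env a.2)
    {e : γ.Input} {δ : γ.Agent → γ.Agent → ExtInt} {n : ℕ} {p : ℕ → γ.Agent}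
    {a : ℕ → TimedEvent γ} {t : ℕ} (h : IsTraversingCentipede r e δ n p a t)
    (ha : (a 0).node ∈ V) : IsTraversingCentipede r' e δ n p a t := by
  obtain ⟨hnd, ⟨t₀, he, hlast⟩, hchain, hpos⟩ := h
  -- Each event of a centipede causally precedes the one before it in the tuple, so closure carries
  -- membership from the head to all of them.
  have hmem : ∀ m ≤ n, (a m).node ∈ V := by
    intro m
    induction m with
    | zero => exact fun _ => ha
    | succ m ih =>
      exact fun hm => ((hchain m hm).syncausal hr (hnd m (by omega)).1).mem_of_mem hcl
        (ih (by omega))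
  have hev : ∀ {b c : TimedEvent γ}, c ∈ r.nd → c.node ∈ V → EventSyncausal r b c →
      EventSyncausal r' b c := by
    rintro b ⟨c, s⟩ hc hcV (hbc | ⟨m, t, i, j, hm, hb⟩)
    · exact .inl hbc
    · obtain rfl : c = .delivery m t i j := hm
      have := SyncStep.message m i j t s (hr.delivery_legal i j m t s hc.1).2.1 hc.1
      exact .inr ⟨m, t, i, j, rfl, hb.of_agree hcl hV (hcl _ _ this hcV)⟩
  refine ⟨fun m hm => ⟨hV _ (hmem m hm) (hnd m hm).1, (hnd m hm).2⟩, ⟨t₀, ?_, ?_⟩, ?_, hpos⟩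
  · exact hV (.input e, t₀) ((hlast.syncausal hr (hnd n le_rfl).1).mem_of_mem hcl
      (hmem n le_rfl)) he
  · exact hev (hnd n le_rfl) (hmem n le_rfl) hlast
  · exact fun m hm => hev (hnd m hm.le) (hmem m hm.le) (hchain m hm)

end Agreement

/-! ### Centipedes are necessary for responding -/

section Necessity

/-- The value `-∞` is impossible because no natural number lies below it; so `y` is an integer with
`0 ≤ a ≤ b + y ≤ c + y`. This is what makes the time positions of a centipede elements of `ℕ`. -/
theorem ExtInt.exists_natCast_eq {a b c : ℕ} {y : ExtInt} (hy : y ≠ ⊤)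
    (h : (a : ExtInt) ≤ (b : ExtInt) + y) (hbc : b ≤ c) :
    ∃ s : ℕ, (s : ExtInt) = (c : ExtInt) + y ∧ a ≤ s := by
  induction y using WithBot.recBotCoe with
  | bot => exact absurd h (by simp)
  | coe y =>
    induction y using WithTop.recTopCoe with
    | top => exact absurd rfl hy
    | coe d =>
      -- Casts and addition in `ExtInt` unfold definitionally to those of `ℤ`.
      have h : (((a : ℤ) : WithTop ℤ) : ExtInt) ≤ (((b + d : ℤ) : WithTop ℤ) : ExtInt) := h
      rw [WithBot.coe_le_coe, WithTop.coe_le_coe] at h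
      refine ⟨(c + d).toNat, ?_, by omega⟩
      change ((((c + d).toNat : ℤ) : WithTop ℤ) : ExtInt) = (((c + d : ℤ) : WithTop ℤ) : ExtInt)
      rw [Int.toNat_of_nonneg (by omega)]

theorem ExtInt.natCast_le {a b : ℕ} : (a : ExtInt) ≤ (b : ExtInt) ↔ a ≤ b := by
  change (((a : ℤ) : WithTop ℤ) : ExtInt) ≤ (((b : ℤ) : WithTop ℤ) : ExtInt) ↔ _
  rw [WithBot.coe_le_coe, WithTop.coe_le_coe, Int.ofNat_le]

theorem ExtInt.natCast_inj {a b : ℕ} (h : (a : ExtInt) = (b : ExtInt)) : a = b :=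
  le_antisymm (ExtInt.natCast_le.1 h.le) (ExtInt.natCast_le.1 h.ge)

theorem pathLength_succ' {A : Type u} (δ : A → A → ExtInt) (p : ℕ → A) (m : ℕ) :
    pathLength δ p (m + 1) = δ (p 0) (p 1) + pathLength δ (fun k => p (k + 1)) m := by
  rw [pathLength, Finset.sum_range_succ', add_comm]
  rfl

theorem IsPath.tail {A : Type u} {I : Set A} {δ : A → A → ExtInt} {n : ℕ} {p : ℕ → A}
    (h : IsPath I δ (n + 1) p) : IsPath I δ n fun k => p (k + 1) :=
  ⟨fun m hm => h.1 (m + 1) (by omega), fun m hm => h.2 (m + 1) (by omega)⟩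

variable {e : γ.Input} {I : Set γ.Agent} {δ : γ.Agent → γ.Agent → ExtInt}

/-- A centipede for the tail of a path can be extended by an event before which its head lies. -/
theorem IsTraversingCentipede.cons {r : History γ} {n : ℕ} {p : ℕ → γ.Agent}
    {a : ℕ → TimedEvent γ} {b : TimedEvent γ} {s t : ℕ}
    (h : IsTraversingCentipede r e δ n (fun k => p (k + 1)) a s)
    (hst : (s : ExtInt) = (t : ExtInt) + δ (p 0) (p 1)) (hb : b ∈ r.nd)
    (hab : EventSyncausal r (a 0) b) (hbt : BoundGuarantee γ b.node (p 0, t)) :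
    ∃ a, IsTraversingCentipede r e δ (n + 1) p a t := by
  obtain ⟨hnd, hlast, hchain, hpos⟩ := h
  refine ⟨fun k => Nat.casesOn k b a, ?_, hlast, ?_, ?_⟩
  · rintro (_ | m) hm
    exacts [hb, hnd m (by omega)]
  · rintro (_ | m) hm
    exacts [hab, hchain m (by omega)]
  · rintro (_ | m) hm
    · exact ⟨t, by simp [pathLength], hbt⟩
    · obtain ⟨s', hs', hg⟩ := hpos m (by omega)
      exact ⟨s', by rw [hs', pathLength_succ', hst, add_assoc], hg⟩

theorem IsTraversingCentipede.tail {r : History γ} {n : ℕ} {p : ℕ → γ.Agent}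
    {a : ℕ → TimedEvent γ} {s t : ℕ} (h : IsTraversingCentipede r e δ (n + 1) p a t)
    (hst : (s : ExtInt) = (t : ExtInt) + δ (p 0) (p 1)) :
    IsTraversingCentipede r e δ n (fun k => p (k + 1)) (fun k => a (k + 1)) s := by
  obtain ⟨hnd, hlast, hchain, hpos⟩ := h
  refine ⟨fun m hm => hnd (m + 1) (by omega), hlast, fun m hm => hchain (m + 1) (by omega),
    fun m hm => ?_⟩
  obtain ⟨s', hs', hg⟩ := hpos (m + 1) (by omega)
  exact ⟨s', by rw [hs', pathLength_succ', hst, add_assoc], hg⟩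

theorem Protocol.respTime_eq {P : Protocol γ} {r : History γ} {i : γ.Agent} {t : ℕ}
    (h : P.Responds r i t) (huniq : ∀ t', P.Responds r i t' → t' = t) : P.respTime r i = t := by
  have : {s : ℕ∞ | ∃ t : ℕ, P.Responds r i t ∧ s = t} = {(t : ℕ∞)} := by
    ext s
    constructor
    · rintro ⟨t', ht', rfl⟩
      rw [huniq t' ht']
      rfl
    · rintro rfl
      exact ⟨t, h, rfl⟩
  rw [Protocol.respTime, this, sInf_singleton]

theorem triggered_of_responds {P : Protocol γ} (hP : P ∈ eventualResponse e I) {r : History γ}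
    (hr : P.IsRun r) {i : γ.Agent} (hi : i ∈ I) {t : ℕ} (h : P.Responds r i t) :
    r.Triggered e := by
  by_contra hn
  exact (hP r hr).2 hn i hi t h

theorem exists_responds_le {P : Protocol γ} (hP : P ∈ timelyCoordinatedResponse e I δ)
    {r : History γ} (hr : P.IsRun r) {i j : γ.Agent} (hi : i ∈ I) (hj : j ∈ I) (hij : i ≠ j)
    {t : ℕ} (h : P.Responds r i t) :
    ∃ t', P.Responds r j t' ∧ (t' : ExtInt) ≤ (t : ExtInt) + δ i j := by
  have htrig := triggered_of_responds hP.1 hr hi h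
  obtain ⟨t', ht', hu'⟩ := (hP.1 r hr).1 htrig j hj
  have hu : ∀ s, P.Responds r i s → s = t := fun s hs =>
    ((hP.1 r hr).1 htrig i hi).unique hs h
  have := hP.2 r hr htrig i hi j hj hij
  simp only [Protocol.respTime_eq h hu, Protocol.respTime_eq ht' hu',
    ENat.toNat_natCast] at this
  exact ⟨t', ht', this⟩

/-- If a protocol solves the timely-coordinated response problem, then an agent can only respond
once all the centipedes for paths starting at this agent exist. -/
theorem exists_centipede {P : Protocol γ} (hP : P ∈ timelyCoordinatedResponse e I δ) (n : ℕ) :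
    ∀ {r : History γ} {p : ℕ → γ.Agent} {t t' : ℕ}, P.IsRun r → IsPath I δ n p →
      P.Responds r (p 0) t' → t' ≤ t → ∃ a, IsTraversingCentipede r e δ n p a t := by
  induction n with
  | zero =>
    intro r p t t' hr hp hresp ht
    obtain ⟨r', hr', hact, henv, -, hin⟩ := hr.exists_truncation
      (V := {y | Syncausal r y (p 0, t)}) (fun y z h hz => .head h hz) (T := t)
      (fun z hz => Syncausal.time_le hz)
    have hresp' : P.Responds r' (p 0) t' := by
      rw [Protocol.Responds, hact (p 0) t' (.of_le (p 0) ht)]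
      exact hresp
    obtain ⟨t₀, ht₀⟩ := triggered_of_responds hP.1 hr' (hp.1 0 le_rfl) hresp'
    have hV := hin e t₀ ht₀
    have he : Event.input e ∈ r.env t₀ := (henv (.input e, t₀) hV).1 ht₀
    obtain ⟨b, hb, heb, hbt⟩ :=
      Syncausal.exists_last_nd hr (a := (.input e, t₀)) ⟨he, trivial⟩ hV
    refine ⟨fun _ => b, fun _ _ => hb, ⟨t₀, he, heb⟩, fun m hm => absurd hm (by omega),
      fun m hm => ⟨t, ?_, ?_⟩⟩
    · simp [pathLength, Nat.le_zero.1 hm]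
    · rw [Nat.le_zero.1 hm]
      exact hbt
  | succ n ih =>
    intro r p t t' hr hp hresp ht
    have hi := hp.1 0 (Nat.zero_le _)
    have hj := hp.1 1 (by omega)
    obtain ⟨hij, htop⟩ := hp.2 0 (Nat.succ_pos n)
    -- The response of `p 1` in `r` serves only to show that `t + δ (p 0) (p 1)` is a natural number
    -- `s`, so that the truncation horizon can be chosen to reach it.
    obtain ⟨t₁, -, hle⟩ := exists_responds_le hP hr hi hj hij hresp
    obtain ⟨s, hs, -⟩ := ExtInt.exists_natCast_eq htop hle ht
    obtain ⟨r', hr', hact, henv, hnd, -⟩ := hr.exists_truncation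
      (V := {y | Syncausal r y (p 0, t)}) (fun y z h hz => .head h hz) (T := max s t)
      (fun z hz => (Syncausal.time_le hz).trans (le_max_right s t))
    have hresp' : P.Responds r' (p 0) t' := by
      rw [Protocol.Responds, hact (p 0) t' (.of_le (p 0) ht)]
      exact hresp
    obtain ⟨t₂, ht₂, hle₂⟩ := exists_responds_le hP hr' hi hj hij hresp'
    obtain ⟨s', hs', hle'⟩ := ExtInt.exists_natCast_eq htop hle₂ ht
    obtain rfl : s = s' := ExtInt.natCast_inj (hs.trans hs'.symm)
    -- In `r'`, `p 1` may respond before `s`; this is why the induction allows `t' ≤ t` rather than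
    -- only `t' = t`.
    obtain ⟨a, ha⟩ := ih hr' hp.tail ht₂ hle'
    obtain ⟨s', hs'', hg⟩ := ha.2.2.2 0 (Nat.zero_le n)
    obtain rfl : s = s' := ExtInt.natCast_inj (by rw [hs'']; simp [pathLength])
    -- The head occurs no later than `s`, within the horizon, and nondeterministic events of `r'` up
    -- to there all lie in the past of `(p 0, t)`.
    have hV : (a 0).node ∈ {y | Syncausal r y (p 0, t)} := by
      refine hnd (a 0) (ha.1 0 (Nat.zero_le n)) ?_
      exact (BoundGuarantee.syncausal (r := r) hg).time_le.trans (le_max_left s t)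
    -- The past is taken in `r` but must be closed under steps of `r'`; since the runs agree on it,
    -- a step of `r'` into it is a step of `r`.
    have hcl : ∀ y z, SyncStep r' y z → z ∈ {y | Syncausal r y (p 0, t)} →
        y ∈ {y | Syncausal r y (p 0, t)} := fun y z h hz =>
      .head (h.of_agree (V := {y | Syncausal r y (p 0, t)})
        (fun a ha => (henv a ha).1) hz) hz
    have ha' := ha.of_agree hr' hcl (fun a ha => (henv a ha).1) hV
    obtain ⟨b, hb, hab, hbt⟩ := Syncausal.exists_last_nd hr (ha'.1 0 (Nat.zero_le n)) hV
    exact ha'.cons hs hb hab hbt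

end Necessity

/-! ### Matching runs -/

section Matching

variable {r₀ r : History γ} {P₀ P : Protocol γ}

theorem Matches.refl (r : History γ) : Matches r r :=
  ⟨fun _ _ => Iff.rfl, fun m _ _ _ s h => ⟨m, s, le_rfl, h⟩⟩

/-- A message that arrives sooner, followed by waiting, replaces the original delivery. -/
theorem Matches.syncStep (hr : P.IsRun r) (hm : Matches r₀ r) {y z : γ.Agent × ℕ}
    (h : SyncStep r₀ y z) : Syncausal r y z := by
  cases h with
  | locality i t t' h => exact .single (.locality i t t' h)
  | guarantee i j t b h hb => exact .single (.guarantee i j t b h hb)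
  | message m i j t t' h hdel =>
    obtain ⟨m', s, hs, hdel'⟩ := hm.2 m t i j t' hdel
    exact .tail (.single (.message m' i j t s (hr.delivery_legal i j m' t s hdel').2.1 hdel'))
      (.locality j s t' hs)

theorem Matches.syncausal (hr : P.IsRun r) (hm : Matches r₀ r) {y z : γ.Agent × ℕ}
    (h : Syncausal r₀ y z) : Syncausal r y z := by
  induction h with
  | refl => exact .refl
  | tail _ h ih => exact ih.trans (hm.syncStep hr h)

/-- The event of a matching run that corresponds to a given nondeterministic event: the same input,
or the delivery of a message sent at the same time along the same channel. -/
theorem Matches.exists_event (hm : Matches r₀ r) (a : TimedEvent γ)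
    (ha : a ∈ r₀.nd) : ∃ a' : TimedEvent γ, a' ∈ r.nd ∧ a'.1.observer = a.1.observer ∧
      a'.2 ≤ a.2 ∧ (∀ f, a.1 = .input f → a' = a) ∧
      ∀ m t i j, a.1 = .delivery m t i j → ∃ m', a'.1 = .delivery m' t i j := by
  obtain ⟨f | ⟨m, t, i, j⟩, s⟩ := a
  · exact ⟨(.input f, s), ⟨(hm.1 f s).1 ha.1, trivial⟩, rfl, le_rfl, fun _ _ => rfl,
      fun _ _ _ _ h => by cases h⟩
  · obtain ⟨hdel, hlt⟩ := ha
    obtain ⟨m', s', hs, hdel'⟩ := hm.2 m t i j s hdel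
    refine ⟨(.delivery m' t i j, s'), ⟨hdel', ?_⟩, rfl, hs, fun _ h => (by cases h), ?_⟩
    -- Delivered no later than an early delivery, the message is again early.
    · exact lt_of_le_of_lt (by exact_mod_cast hs) hlt
    · rintro _ _ _ _ ⟨⟩
      exact ⟨m', rfl⟩

theorem Matches.exists_centipede (hr : P.IsRun r) (hm : Matches r₀ r) {e : γ.Input}
    {δ : γ.Agent → γ.Agent → ExtInt} {n : ℕ} {p : ℕ → γ.Agent} {a : ℕ → TimedEvent γ} {t : ℕ}
    (h : IsTraversingCentipede r₀ e δ n p a t) : ∃ a', IsTraversingCentipede r e δ n p a' t := by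
  obtain ⟨hnd, ⟨t₀, he, hlast⟩, hchain, hpos⟩ := h
  have hex : ∀ b : TimedEvent γ, ∃ b' : TimedEvent γ, b ∈ r₀.nd → b' ∈ r.nd ∧
      b'.1.observer = b.1.observer ∧ b'.2 ≤ b.2 ∧ (∀ f, b.1 = .input f → b' = b) ∧
      ∀ m t i j, b.1 = .delivery m t i j → ∃ m', b'.1 = .delivery m' t i j := fun b => by
    by_cases hb : b ∈ r₀.nd
    · obtain ⟨b', hb'⟩ := hm.exists_event b hb
      exact ⟨b', fun _ => hb'⟩
    · exact ⟨b, fun h => absurd h hb⟩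
  choose φ hφ using hex
  have hnode : ∀ {b : TimedEvent γ}, b ∈ r₀.nd → BoundStep γ (φ b).node b.node := fun {b} hb => by
    obtain ⟨-, hobs, hle, -⟩ := hφ b hb
    rw [TimedEvent.node, TimedEvent.node, hobs]
    exact .locality _ _ _ hle
  have hev : ∀ {b c : TimedEvent γ}, b ∈ r₀.nd → c ∈ r₀.nd → EventSyncausal r₀ b c →
      EventSyncausal r (φ b) (φ c) := by
    rintro b c hb hc (rfl | ⟨m, t, i, j, hdel, hb'⟩)
    · exact .inl rfl
    · obtain ⟨m', hm'⟩ := (hφ c hc).2.2.2.2 m t i j hdel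
      exact .inr ⟨m', t, i, j, hm', .head (hnode hb).syncStep (hm.syncausal hr hb')⟩
  have he₀ : ((Event.input e, t₀) : TimedEvent γ) ∈ r₀.nd := ⟨he, trivial⟩
  refine ⟨fun k => φ (a k), fun m hm => (hφ _ (hnd m hm)).1, ⟨t₀, (hm.1 e t₀).1 he, ?_⟩,
    fun m hm => hev (hnd (m + 1) hm) (hnd m hm.le) (hchain m hm), fun m hm => ?_⟩
  · have := hev he₀ (hnd n le_rfl) hlast
    rwa [(hφ _ he₀).2.2.2.1 e rfl] at this
  · obtain ⟨s, hs, hg⟩ := hpos m hm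
    exact ⟨s, hs, .head (hnode (hnd m hm)) hg⟩

/-- Each run of any protocol is matched by a run of a given full-information protocol. -/
theorem Protocol.IsFullInformation.exists_matches (hP : P.IsFullInformation)
    (hr₀ : P₀.IsRun r₀) : ∃ r, P.IsRun r ∧ Matches r₀ r := by
  classical
  obtain ⟨-, decode, hsend⟩ := hP
  -- `P₀` may send several messages along a channel at once, `P` sends just one; it is delivered
  -- with the earliest of them.
  have hex : ∀ t i j, ∃ d : ℕ, (γ.Nbr i j → t < d ∧ (d : ℕ∞) ≤ t + γ.bound i j) ∧
      ∀ m s, Event.delivery m t i j ∈ r₀.env s → d ≤ s := by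
    intro t i j
    by_cases h : ∃ s, ∃ m, Event.delivery m t i j ∈ r₀.env s
    · obtain ⟨m, hm⟩ := Nat.find_spec h
      exact ⟨Nat.find h, fun _ => (hr₀.delivery_legal i j m t _ hm).2,
        fun m s hs => Nat.find_min' h ⟨m, hs⟩⟩
    · obtain ⟨d, hd, -⟩ := γ.exists_late 0 t i j
      exact ⟨d, hd, fun m s hs => absurd ⟨s, m, hs⟩ h⟩
  choose D hD hle using hex
  obtain ⟨r, hr, -, hinp, hdel⟩ := P.exists_isRun (fun i => (P.init_nonempty i).some_mem)
    (inp := fun e t => Event.input e ∈ r₀.env t) hr₀.input_once (D := fun _ => D) fun _ => hD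
  refine ⟨r, hr, fun e t => (hinp e t).symm, fun m t i j s hs => ?_⟩
  obtain ⟨m', hm', -⟩ := (hsend r hr i j t (hr₀.delivery_legal i j m t s hs).1.choose).1
  exact ⟨m', D t i j, hle t i j m s hs, (hdel m' t i j _).2 ⟨hm', rfl⟩⟩

/-- Each run of a full-information protocol matches a run of any given protocol. -/
theorem Protocol.IsFullInformation.exists_matched (hP : P.IsFullInformation) (hr : P.IsRun r)
    (P₀ : Protocol γ) : ∃ r₀, P₀.IsRun r₀ ∧ Matches r₀ r := by
  obtain ⟨-, decode, hsend⟩ := hP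
  -- Whatever `P₀` sends along a channel at time `t` is to be delivered together with the message
  -- that `P` sends there at `t`.
  have hex : ∀ t i j, ∃ d : ℕ, γ.Nbr i j → (t < d ∧ (d : ℕ∞) ≤ t + γ.bound i j) ∧
      ∃ m, Event.delivery m t i j ∈ r.env d := by
    intro t i j
    by_cases hN : γ.Nbr i j
    · obtain ⟨m, hm, -⟩ := (hsend r hr i j t hN).1
      obtain ⟨d, hd, -⟩ := hr.delivered i j m t hm
      exact ⟨d, fun _ => ⟨(hr.delivery_legal i j m t d hd).2, m, hd⟩⟩
    · exact ⟨0, fun h => absurd h hN⟩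
  choose D hD using hex
  obtain ⟨r₀, hr₀, -, hinp, hdel⟩ := P₀.exists_isRun (fun i => (P₀.init_nonempty i).some_mem)
    (inp := fun e t => Event.input e ∈ r.env t) hr.input_once (D := fun _ => D)
    fun _ t i j h => (hD t i j h).1
  refine ⟨r₀, hr₀, hinp, fun m t i j s hs => ?_⟩
  obtain ⟨hm, rfl⟩ := (hdel m t i j s).1 hs
  obtain ⟨m', hm'⟩ := (hD t i j hm.choose).2
  exact ⟨m', _, le_rfl, hm'⟩

end Matching

/-! ### Implementing the logic in a full-information protocol -/

section Endowment

variable {P P' : Protocol γ} {r r' : History γ} {e : γ.Input} {I : Set γ.Agent}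
  {δ : γ.Agent → γ.Agent → ExtInt}

theorem History.observedUpTo_eq_of_le {i : γ.Agent} {s t : ℕ} (hst : s ≤ t)
    (h : r.observedUpTo i t = r'.observedUpTo i t) :
    r.observedUpTo i s = r'.observedUpTo i s := by
  ext a
  have := Set.ext_iff.1 h a
  constructor
  · rintro ⟨h1, h2⟩
    exact ⟨h1, (this.1 ⟨h1.trans hst, h2⟩).2⟩
  · rintro ⟨h1, h2⟩
    exact ⟨h1, (this.2 ⟨h1.trans hst, h2⟩).2⟩

/-- In runs of a full-information protocol, what an agent observes determines what is observed at
all agent-time pairs in the causal past. -/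
theorem Protocol.IsFullInformation.observedUpTo_eq (hP : P.IsFullInformation) (hr : P.IsRun r)
    (hr' : P.IsRun r') {y z : γ.Agent × ℕ} (hyz : Syncausal r y z)
    (h : r.observedUpTo z.1 z.2 = r'.observedUpTo z.1 z.2) :
    r.observedUpTo y.1 y.2 = r'.observedUpTo y.1 y.2 := by
  obtain ⟨⟨remember, hrem⟩, decode, hsend⟩ := hP
  have hmsg : ∀ {m t i j t' T}, Event.delivery m t i j ∈ r.env t' → t' ≤ T →
      r.observedUpTo j T = r'.observedUpTo j T →
      r.observedUpTo i t = r'.observedUpTo i t := by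
    intro m t i j t' T hm hT h
    have hm' : Event.delivery m t i j ∈ r'.env t' :=
      ((Set.ext_iff.1 h (.delivery m t i j, t')).1 ⟨hT, hm, rfl⟩).2.1
    have hs := (hr.delivery_legal i j m t t' hm).1
    have hs' := (hr'.delivery_legal i j m t t' hm').1
    have hN := hs.choose
    have := ((hsend r hr i j t hN).2 m hs).symm.trans ((hsend r' hr' i j t hN).2 m hs')
    rw [← hrem r hr, ← hrem r' hr', (Prod.mk.inj this).1]
  induction hyz using Relation.ReflTransGen.head_induction_on with
  | refl => exact h
  | head hstep _ ih =>
    cases hstep with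
    | locality i t t' hle => exact History.observedUpTo_eq_of_le hle ih
    | message m i j t t' _ hm => exact hmsg hm le_rfl ih
    -- A guarantee step alone carries no information, but the message sent at `t` has arrived by `t
    -- + b`.
    | guarantee i j t b hN hb =>
      obtain ⟨m, hm, -⟩ := (hsend r hr i j t hN).1
      obtain ⟨t', ht', -⟩ := hr.delivered i j m t hm
      have hle := (hr.delivery_legal i j m t t' ht').2.2
      rw [hb] at hle
      exact hmsg ht' (by exact_mod_cast hle) ih

/-- The events of such centipedes lie in the causal past of `(i, t)`, on which the two runs agree.
The positions `(p m, s)` may be later than `t`, but they are reached by bound guarantees, which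
depend on the context only. -/
theorem AllCentipedesBy.of_observedUpTo_eq (hP : P.IsFullInformation) (hr : P.IsRun r)
    (hr' : P.IsRun r') {i : γ.Agent} {t : ℕ}
    (h : r.observedUpTo i t = r'.observedUpTo i t) (hc : AllCentipedesBy e I δ r i t) :
    AllCentipedesBy e I δ r' i t := by
  rintro n p hp rfl
  obtain ⟨a, ha⟩ := hc n p hp rfl
  refine ⟨a, ha.of_agree (V := {y | Syncausal r y (p 0, t)}) hr (fun y z h hz => .head h hz)
    (fun b hb hbr => ?_) ?_⟩
  · have := hP.observedUpTo_eq hr hr' hb h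
    exact ((Set.ext_iff.1 this b).1 ⟨le_rfl, hbr, rfl⟩).2.1
  · obtain ⟨s, hs, hg⟩ := ha.2.2.2 0 (Nat.zero_le n)
    obtain rfl : t = s := ExtInt.natCast_inj (by rw [hs]; simp [pathLength])
    exact hg.syncausal

/-- Minimality transfers as well, since equal observations up to `t` are equal up to every earlier
time. -/
theorem centipedeLogic_of_observedUpTo_eq (hP : P.IsFullInformation) (hr : P.IsRun r)
    (hr' : P.IsRun r') {i : γ.Agent} {t : ℕ}
    (h : r.observedUpTo i t = r'.observedUpTo i t) (hc : centipedeLogic e I δ r i t) :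
    centipedeLogic e I δ r' i t := by
  refine ⟨hc.1.of_observedUpTo_eq hP hr hr' h, fun s hs => ?_⟩
  by_contra hlt
  have hle : s ≤ t := by omega
  exact hlt (hc.2 (AllCentipedesBy.of_observedUpTo_eq hP hr' hr
    (History.observedUpTo_eq_of_le hle h).symm hs))

theorem Protocol.isRun_congr (hinit : ∀ i, P'.init i = P.init i)
    (hstate : ∀ i s E M t, (P'.act i s E M t).state = (P.act i s E M t).state)
    (hsend : ∀ i s E M t, (P'.act i s E M t).send = (P.act i s E M t).send) :
    P'.IsRun r ↔ P.IsRun r := by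
  have hS : ∀ i j m t, P'.Sends r i j m t ↔ P.Sends r i j m t := fun i j m t => by
    simp only [Protocol.Sends, Protocol.actionAt, hsend]
  constructor
  · rintro ⟨h1, h2, h3, h4, h5⟩
    refine ⟨fun i => hinit i ▸ h1 i, fun i t => (h2 i t).trans (hstate _ _ _ _ _), h3,
      fun i j m t h => h4 i j m t ((hS _ _ _ _).2 h), fun i j m t t' h => ?_⟩
    exact ⟨(hS _ _ _ _).1 (h5 i j m t t' h).1, (h5 i j m t t' h).2⟩
  · rintro ⟨h1, h2, h3, h4, h5⟩
    refine ⟨fun i => (hinit i).symm ▸ h1 i, fun i t => (h2 i t).trans (hstate _ _ _ _ _).symm, h3,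
      fun i j m t h => h4 i j m t ((hS _ _ _ _).1 h), fun i j m t t' h => ?_⟩
    exact ⟨(hS _ _ _ _).2 (h5 i j m t t' h).1, (h5 i j m t t' h).2⟩

theorem EndowedWith.runs_eq {ρ : ResponseLogic γ} (h : EndowedWith I ρ P P') :
    P'.runs = P.runs :=
  Set.ext fun _ => Protocol.isRun_congr h.init_eq h.state_eq h.send_eq

/-- A full-information protocol can be endowed with the centipede logic. -/
theorem Protocol.IsFullInformation.exists_endowedWith (hP : P.IsFullInformation) (e : γ.Input)
    (I : Set γ.Agent) (δ : γ.Agent → γ.Agent → ExtInt) :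
    ∃ P', EndowedWith I (centipedeLogic e I δ) P P' := by
  let P' : Protocol γ :=
    { init := P.init
      init_nonempty := P.init_nonempty
      act := fun i s E M t =>
        { state := (P.act i s E M t).state
          send := (P.act i s E M t).send
          -- The agent responds if the logic says so in some run with the same local data; the logic
          -- then says so in all of them, because the resulting state determines the observations.
          respond := (i ∈ I ∧ ∃ r ∈ P.runs, r.before i t = s ∧ r.inputsAt i t = E ∧
            r.messagesAt i t = M ∧ centipedeLogic e I δ r i t) ∨
            i ∉ I ∧ (P.act i s E M t).respond } }
  have hrun : ∀ {r}, P'.IsRun r ↔ P.IsRun r :=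
    Protocol.isRun_congr (fun _ => rfl) (fun _ _ _ _ _ => rfl) (fun _ _ _ _ _ => rfl)
  refine ⟨P', fun _ => rfl, fun _ _ _ _ _ => rfl, fun _ _ _ _ _ => rfl,
    fun i hi s E M t => ?_, fun r hr i hi t => ?_⟩
  · simp [P', hi]
  · have hr : P.IsRun r := hrun.1 hr
    constructor
    · rintro (⟨-, r', hr', hb, hin, hm, hc⟩ | ⟨hn, -⟩)
      · have hstate : r'.state i t = r.state i t := by
          rw [hr.state_eq, Protocol.IsRun.state_eq hr', Protocol.actionAt, Protocol.actionAt,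
            hb, hin, hm]
        obtain ⟨remember, hrem⟩ := hP.1
        refine centipedeLogic_of_observedUpTo_eq hP hr' hr ?_ hc
        rw [← hrem r' hr', ← hrem r hr, hstate]
      · exact absurd hi hn
    · exact fun hc => .inl ⟨hi, r, hr, rfl, rfl, rfl, hc⟩

end Endowment

/-! ### Correctness and optimality of the logic -/

section Optimality

variable {P₀ P P' : Protocol γ} {r₀ r : History γ} {e : γ.Input} {I : Set γ.Agent}
  {δ : γ.Agent → γ.Agent → ExtInt}

theorem AllCentipedesBy.triggered {i : γ.Agent} (hi : i ∈ I) {t : ℕ}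
    (h : AllCentipedesBy e I δ r i t) : r.Triggered e := by
  obtain ⟨a, -, ⟨t₀, ht₀, -⟩, -⟩ :=
    h 0 (fun _ => i) ⟨fun _ _ => hi, fun m hm => absurd hm (Nat.not_lt_zero m)⟩ rfl
  exact ⟨t₀, ht₀⟩

/-- Prepend `i` to every path from `j` and drop the head of the resulting centipede. This is how the
logic satisfies the constraint `δ i j`. -/
theorem AllCentipedesBy.exists_of_edge {i j : γ.Agent} (hi : i ∈ I) (hj : j ∈ I) (hij : i ≠ j)
    (hδ : δ i j ≠ ⊤) {t : ℕ} (h : AllCentipedesBy e I δ r i t) :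
    ∃ s : ℕ, (s : ExtInt) = (t : ExtInt) + δ i j ∧ AllCentipedesBy e I δ r j s := by
  have hpath : ∀ (n : ℕ) (p : ℕ → γ.Agent), IsPath I δ n p → p 0 = j →
      IsPath I δ (n + 1) fun k => Nat.casesOn k i p := by
    rintro n p hp rfl
    refine ⟨?_, ?_⟩
    · rintro (_ | m) hm
      exacts [hi, hp.1 m (by omega)]
    · rintro (_ | m) hm
      exacts [⟨hij, hδ⟩, hp.2 m (by omega)]
  -- The path `(i, j)` alone shows that `t + δ i j` is a natural number; in particular `δ i j` is
  -- not `-∞`.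
  obtain ⟨a, -, -, -, ha⟩ := h 1 _ (hpath 0 (fun _ => j)
    ⟨fun _ _ => hj, fun m hm => absurd hm (Nat.not_lt_zero m)⟩ rfl) rfl
  obtain ⟨s, hs, -⟩ := ha 1 le_rfl
  have hs : (s : ExtInt) = (t : ExtInt) + δ i j := by simpa [pathLength] using hs
  refine ⟨s, hs, ?_⟩
  rintro n p hp rfl
  obtain ⟨a, ha⟩ := h (n + 1) _ (hpath n p hp rfl) rfl
  exact ⟨_, ha.tail hs⟩

theorem Matches.allCentipedesBy (hP₀ : P₀ ∈ timelyCoordinatedResponse e I δ) (hr₀ : P₀.IsRun r₀)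
    (hr : P.IsRun r) (hm : Matches r₀ r) {i : γ.Agent} {t : ℕ} (h : P₀.Responds r₀ i t) :
    AllCentipedesBy e I δ r i t := by
  rintro n p hp rfl
  obtain ⟨a, ha⟩ := TimelyResponse.exists_centipede hP₀ n hr₀ hp h le_rfl
  exact hm.exists_centipede hr ha

theorem EndowedWith.respTime_eq (hP' : EndowedWith I (centipedeLogic e I δ) P P')
    (hr : P'.IsRun r) {i : γ.Agent} (hi : i ∈ I) {t : ℕ} (h : centipedeLogic e I δ r i t) :
    P'.respTime r i = t :=
  P'.respTime_eq ((hP'.follows r hr i hi t).2 h) fun t' ht' =>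
    IsLeast.unique ((hP'.follows r hr i hi t').1 ht') h

theorem AllCentipedesBy.exists_centipedeLogic {i : γ.Agent} {t : ℕ}
    (h : AllCentipedesBy e I δ r i t) : ∃ s ≤ t, centipedeLogic e I δ r i s := by
  classical
  exact ⟨Nat.find ⟨t, h⟩, Nat.find_min' ⟨t, h⟩ h, Nat.find_spec ⟨t, h⟩,
    fun s hs => Nat.find_min' ⟨t, h⟩ hs⟩

theorem EndowedWith.respTime_le (hP' : EndowedWith I (centipedeLogic e I δ) P P')
    (hP₀ : P₀ ∈ timelyCoordinatedResponse e I δ) (hr₀ : P₀.IsRun r₀) (hr : P'.IsRun r)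
    (hm : Matches r₀ r) {i : γ.Agent} (hi : i ∈ I) : P'.respTime r i ≤ P₀.respTime r₀ i := by
  -- If `i` never responds in `r₀`, the infimum is over the empty set, hence `∞`.
  refine le_sInf ?_
  rintro _ ⟨t, ht, rfl⟩
  obtain ⟨s, hs, hc⟩ := (hm.allCentipedesBy hP₀ hr₀ hr ht).exists_centipedeLogic
  rw [hP'.respTime_eq hr hi hc]
  exact_mod_cast hs

/-- A full-information protocol endowed with the centipede logic solves the timely-coordinated
response problem if this problem is solvable. -/
theorem EndowedWith.mem_timelyCoordinatedResponse (hP : P.IsFullInformation)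
    (hP' : EndowedWith I (centipedeLogic e I δ) P P')
    (hP₀ : P₀ ∈ timelyCoordinatedResponse e I δ) : P' ∈ timelyCoordinatedResponse e I δ := by
  have hex : ∀ r, P'.IsRun r → r.Triggered e → ∀ i ∈ I, ∃ t, centipedeLogic e I δ r i t := by
    rintro r hr ⟨t₀, ht₀⟩ i hi
    have hrP : P.IsRun r := hP'.runs_eq.subset hr
    -- Solvability enters here: the solving protocol responds in a run with the same inputs, and the
    -- centipedes this forces carry over to `r`.
    obtain ⟨r₀, hr₀, hm⟩ := hP.exists_matched hrP P₀
    obtain ⟨t, ht, -⟩ := (hP₀.1 r₀ hr₀).1 ⟨t₀, (hm.1 e t₀).2 ht₀⟩ i hi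
    obtain ⟨s, -, hs⟩ := (hm.allCentipedesBy hP₀ hr₀ hrP ht).exists_centipedeLogic
    exact ⟨s, hs⟩
  refine ⟨fun r hr => ⟨fun htrig i hi => ?_, fun hn i hi t ht => ?_⟩, fun r hr htrig => ?_⟩
  · obtain ⟨t, ht⟩ := hex r hr htrig i hi
    exact ⟨t, (hP'.follows r hr i hi t).2 ht, fun s hs =>
      IsLeast.unique ((hP'.follows r hr i hi s).1 hs) ht⟩
  · exact hn (((hP'.follows r hr i hi t).1 ht).1.triggered hi)
  · intro i hi j hj hij
    obtain ⟨t, ht⟩ := hex r hr htrig i hi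
    obtain ⟨t', ht'⟩ := hex r hr htrig j hj
    simp only [hP'.respTime_eq hr hi ht, hP'.respTime_eq hr hj ht', ENat.toNat_natCast]
    by_cases hδ : δ i j = ⊤
    · have : (t : ExtInt) + δ i j = ⊤ := by
        rw [hδ]
        rfl
      rw [this]
      exact le_top
    · obtain ⟨s, hs, hc⟩ := AllCentipedesBy.exists_of_edge hi hj hij hδ ht.1
      rw [← hs]
      exact ExtInt.natCast_le.2 (ht'.2 hc)

end Optimality

end TimelyResponse

theorem mainTheorem2 (γ : TimelyResponse.Context.{u, v, w, x}) (e : γ.Input) (I : Set γ.Agent)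
    (δ : γ.Agent → γ.Agent → TimelyResponse.ExtInt) :
    TimelyResponse.IsOptimalResponseLogic I
      (TimelyResponse.timelyCoordinatedResponse e I δ)
      (TimelyResponse.centipedeLogic e I δ) := by
  rintro ⟨P₁, hP₁⟩ P hP
  refine ⟨hP.exists_endowedWith e I δ, fun P' hP' => ⟨hP'.mem_timelyCoordinatedResponse hP hP₁,
    hP'.runs_eq, fun hPCP r hr i hi => ?_, fun P₀ hP₀ r₀ hr₀ => ⟨?_, fun r hr hm i hi => ?_⟩⟩⟩
  · exact hP'.respTime_le hPCP hr (hP'.runs_eq.symm.subset hr) (.refl r) hi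
  · obtain ⟨r, hr, hm⟩ := hP.exists_matches hr₀
    exact ⟨r, hP'.runs_eq.symm.subset hr, hm⟩
  · exact hP'.respTime_le hP₀ hr₀ hr hm hi
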